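/- Let $V=\bigoplus_{n\in\mathbb Z}V_n$ be a vertex operator algebra over $\mathbb C$ of CFT type, that is, $V_n=0$ for $n<0$ and $V_0=\mathbb C\mathbf 1$. A weak $V$-module is a complex vector space $W$ with a linear map $V\to \mathrm{End}(W)[[z,z^{-1}]]$, $v\mapsto Y_W(v,z)=\sum_{n\in\mathbb Z}v_nz^{-n-1}$, such that $v_nw=0$ for $n\gg0$ (for each $v\in V$, $w\in W$), $Y_W(\mathbf 1,z)=\mathrm{id}_W$, and the Jacobi identity $$z_0^{-1}\delta\Big(\frac{z_1-z_2}{z_0}\Big)Y_W(u,z_1)Y_W(v,z_2)-z_0^{-1}\delta\Big(\frac{z_2-z_1}{-z_0}\Big)Y_W(v,z_2)Y_W(u,z_1)=z_2^{-1}\delta\Big(\frac{z_1-z_0}{z_2}\Big)Y_W(Y(u,z_0)v,z_2)$$ holds for all $u,v\in V$; no grading on $W$ is assumed. It is irreducible if $W\neq0$ and the only subspaces of $W$ stable under all operators $v_n$ ($v\in V$, $n\in\mathbb Z$) are $0$ and $W$. Let $C_2(V)$ be the linear span of $\{u_{-2}v : u,v\in V\}$ and $C_2(W)$ the linear span of $\{u_{-2}w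 : u\in V,\ w\in W\}$. Proposition. If $V$ is $C_2$-cofinite, i.e. $\dim V/C_2(V)<\infty$, and $W$ is an irreducible weak $V$-module, then $W$ is $C_2$-cofinite, i.e. $\dim W/C_2(W)<\infty$. -/

import Mathlib

/-- The Jacobi identity for `Y(v, z) = ∑ v_n z^{-n-1}` on `V` and `Y_W(v, z) = ∑ v_n z^{-n-1}` on
`W`, where the `n`-th modes are `Y v n` and `Y_W v n`:
`z₀⁻¹ δ((z₁-z₂)/z₀) Y_W(u,z₁) Y_W(v,z₂) - z₀⁻¹ δ((z₂-z₁)/(-z₀)) Y_W(v,z₂) Y_W(u,z₁)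
  = z₂⁻¹ δ((z₁-z₀)/z₂) Y_W(Y(u,z₀)v, z₂)`.
It is written as the equality, on every vector `w`, of the coefficients of
`z₀^{-l-1} z₁^{-m-1} z₂^{-n-1}` for all integers `l, m, n`; every power of a binomial is expanded in
non-negative integral powers of its second variable. The sums are finite as soon as `Y` and `Y_W`
satisfy the truncation condition. -/
def JacobiIdentity {V W : Type*} [AddCommGroup V] [Module ℂ V] [AddCommGroup W] [Module ℂ W]
    (Y : V →ₗ[ℂ] (ℤ → Module.End ℂ V)) (Y_W : V →ₗ[ℂ] (ℤ → Module.End ℂ W)) : Prop :=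
  ∀ (u v : V) (w : W) (l m n : ℤ),
    (∑ᶠ i : ℕ, ((-1 : ℂ) ^ i * ((Ring.choose l i : ℤ) : ℂ)) •
        Y_W u (m + l - i) (Y_W v (n + i) w))
      - (∑ᶠ i : ℕ, ((-1 : ℂ) ^ l * (-1 : ℂ) ^ i * ((Ring.choose l i : ℤ) : ℂ)) •
        Y_W v (n + l - i) (Y_W u (m + i) w))
    = ∑ᶠ i : ℕ, ((Ring.choose m i : ℤ) : ℂ) • Y_W (Y u (l + i) v) (m + n - i) w

/-- A vertex operator algebra structure (over `ℂ`) on the vector space `V`. -/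
structure VertexOperatorAlgebra (V : Type*) [AddCommGroup V] [Module ℂ V] where
  /-- The homogeneous subspaces `V_n`. -/
  grading : ℤ → Submodule ℂ V
  isInternal : DirectSum.IsInternal grading
  finiteDimensional : ∀ n, FiniteDimensional ℂ (grading n)
  grading_eq_bot : ∃ N : ℤ, ∀ n < N, grading n = ⊥
  /-- The state-field correspondence: `Y v n` is the mode `v_n` in `Y(v, z) = ∑ v_n z^{-n-1}`. -/
  Y : V →ₗ[ℂ] (ℤ → Module.End ℂ V)
  /-- The vacuum vector `𝟏`. -/
  vacuum : V
  /-- The conformal (Virasoro) vector `ω`. -/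
  conformal : V
  /-- The central charge `c`. -/
  centralCharge : ℂ
  vacuum_mem : vacuum ∈ grading 0
  conformal_mem : conformal ∈ grading 2
  truncation : ∀ u v : V, ∃ N : ℤ, ∀ n ≥ N, Y u n v = 0
  /-- `Y(𝟏, z) = id`. -/
  vacuum_mode : ∀ n : ℤ, Y vacuum n = if n = -1 then LinearMap.id else 0
  /-- `Y(v, z)𝟏` has no negative powers of `z`. -/
  creation : ∀ (v : V) (n : ℤ), 0 ≤ n → Y v n vacuum = 0
  /-- The constant term of `Y(v, z)𝟏` is `v`. -/
  creation_const : ∀ v : V, Y v (-1) vacuum = v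
  jacobi : JacobiIdentity Y Y
  /-- The Virasoro relations for `L(n) = ω_{n+1}`. -/
  virasoro : ∀ m n : ℤ,
    Y conformal (m + 1) * Y conformal (n + 1) - Y conformal (n + 1) * Y conformal (m + 1) =
      ((m : ℂ) - n) • Y conformal (m + n + 1) +
        if m + n = 0 then (((m : ℂ) ^ 3 - m) / 12 * centralCharge) • LinearMap.id else 0
  /-- `L(0)` acts on `V_n` as multiplication by `n`. -/
  L_zero : ∀ (n : ℤ), ∀ v ∈ grading n, Y conformal 1 v = (n : ℂ) • v
  /-- `Y(L(-1)v, z) = d/dz Y(v, z)`. -/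
  L_neg_one : ∀ (v : V) (n : ℤ), Y (Y conformal 0 v) n = (-(n : ℂ)) • Y v (n - 1)

namespace VertexOperatorAlgebra

/-- `V` is of CFT type: `V = ⨁_{n ≥ 0} V_n` and `V_0 = ℂ𝟏`. -/
def IsCFTType {V : Type*} [AddCommGroup V] [Module ℂ V] (A : VertexOperatorAlgebra V) : Prop :=
  (∀ n < 0, A.grading n = ⊥) ∧ A.grading 0 = Submodule.span ℂ {A.vacuum}

/-- `C_n(V)`: the linear span of the vectors `u_{-n} v` with `u, v ∈ V`. -/
def C {V : Type*} [AddCommGroup V] [Module ℂ V] (A : VertexOperatorAlgebra V) (n : ℕ) :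
    Submodule ℂ V :=
  Submodule.span ℂ {x | ∃ u v : V, A.Y u (-(n : ℤ)) v = x}

/-- `V` is `C_n`-cofinite: `V / C_n(V)` is finite dimensional. -/
def IsCofinite {V : Type*} [AddCommGroup V] [Module ℂ V] (A : VertexOperatorAlgebra V)
    (n : ℕ) : Prop :=
  FiniteDimensional ℂ (V ⧸ A.C n)

/-- A weak module structure on the vector space `W` over the vertex operator algebra `A`.
No grading is assumed. -/
structure WeakModule {V : Type*} [AddCommGroup V] [Module ℂ V] (A : VertexOperatorAlgebra V)
    (W : Type*) [AddCommGroup W] [Module ℂ W] where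
  /-- `Y v n` is the mode `v_n` in `Y_W(v, z) = ∑ v_n z^{-n-1}`. -/
  Y : V →ₗ[ℂ] (ℤ → Module.End ℂ W)
  truncation : ∀ (v : V) (w : W), ∃ N : ℤ, ∀ n ≥ N, Y v n w = 0
  /-- `Y_W(𝟏, z) = id`. -/
  vacuum_mode : ∀ n : ℤ, Y A.vacuum n = if n = -1 then LinearMap.id else 0
  jacobi : JacobiIdentity A.Y Y

namespace WeakModule

/-- `W` is irreducible: it is nonzero, and its only weak submodules (subspaces stable under all
modes `v_n`) are `0` and `W`. -/
def IsIrreducible {V : Type*} [AddCommGroup V] [Module ℂ V] {A : VertexOperatorAlgebra V}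
    {W : Type*} [AddCommGroup W] [Module ℂ W] (M : A.WeakModule W) : Prop :=
  Nontrivial W ∧ ∀ U : Submodule ℂ W,
    (∀ (v : V) (n : ℤ), ∀ w ∈ U, M.Y v n w ∈ U) → U = ⊥ ∨ U = ⊤

/-- `C_n(W)`: the linear span of the vectors `u_{-n} w` with `u ∈ V`, `w ∈ W`. -/
def C {V : Type*} [AddCommGroup V] [Module ℂ V] {A : VertexOperatorAlgebra V}
    {W : Type*} [AddCommGroup W] [Module ℂ W] (M : A.WeakModule W) (n : ℕ) : Submodule ℂ W :=
  Submodule.span ℂ {x | ∃ (u : V) (w : W), M.Y u (-(n : ℤ)) w = x}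

/-- `W` is `C_n`-cofinite: `W / C_n(W)` is finite dimensional. -/
def IsCofinite {V : Type*} [AddCommGroup V] [Module ℂ V] {A : VertexOperatorAlgebra V}
    {W : Type*} [AddCommGroup W] [Module ℂ W] (M : A.WeakModule W) (n : ℕ) : Prop :=
  FiniteDimensional ℂ (W ⧸ M.C n)

end WeakModule

end VertexOperatorAlgebra

/-!
Filter `W` by the total conformal weight of the modes applied to a finite generating set. On the
associated graded space `G` all modes commute, and `f_u(z) = ∑ u_n z^{-n-1}` depends only on the
class of `u` modulo `C_2(V)`, is `1` for the vacuum and satisfies `f_{u_{-1}v} = f_u f_v`. So, if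
`R` denotes the commutative algebra of operators on `G` generated by the modes, the series `f_u`
form a finite-dimensional subalgebra of `R((z))`. Each `f_u` is therefore integral over `ℂ`, and
then so are its coefficients: modulo a prime of `R`, a Laurent series which is algebraic over `ℂ`
is constant. The modes `u_m` with `m > -n` span a finite-dimensional space, because `V / C_2(V)`
is finite dimensional. Hence `R` modulo the ideal generated by the modes `u_m` with `m ≤ -n` is
finite dimensional. As `G` is finitely generated over `R`, the images of these modes span a
subspace of finite codimension in `G`, and this lifts to `C_n(W) ⊆ W`.
-/

section HahnSeriesCoefficients

open Polynomial

theorem hahnSeries_coeff_mul_eq_sum_range {R : Type*} [Semiring R] {f g : HahnSeries ℤ R} {a k : ℤ}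
    {N : ℕ} (hf : ∀ j < a, f.coeff j = 0) (hg : ∀ j ≤ k - a - N, g.coeff j = 0) :
    (f * g).coeff k = ∑ i ∈ Finset.range N, f.coeff (a + i) * g.coeff (k - a - i) := by
  let φ : ℕ ↪ ℤ × ℤ := ⟨fun i => (a + i, k - a - i), fun i j hij => by simpa using hij⟩
  rw [HahnSeries.coeff_mul]
  refine Eq.trans ?_ (Finset.sum_map (Finset.range N) φ fun q => f.coeff q.1 * g.coeff q.2)
  refine Finset.sum_subset (fun q hq => ?_) fun q hq hq' => ?_
  · obtain ⟨hqf, hqg, hqk⟩ := Finset.mem_antidiagonal.mp hq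
    have hqa : a ≤ q.1 := not_lt.mp fun h => hqf (hf _ h)
    have hqN : k - a - N < q.2 := not_le.mp fun h => hqg (hg _ h)
    exact Finset.mem_map.mpr ⟨(q.1 - a).toNat, Finset.mem_range.mpr (by omega),
      Prod.ext (show a + ((q.1 - a).toNat : ℤ) = q.1 by omega)
        (show k - a - ((q.1 - a).toNat : ℤ) = q.2 by omega)⟩
  · contrapose! hq'
    obtain ⟨i, -, rfl⟩ := Finset.mem_map.mp hq
    exact Finset.mem_antidiagonal.mpr ⟨left_ne_zero_of_mul hq', right_ne_zero_of_mul hq',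
      show a + (i : ℤ) + (k - a - i) = k by ring⟩

/-- The ring homomorphism of Hahn series induced by a ring homomorphism of the coefficients. -/
def hahnSeriesMap (Γ : Type*) [AddCommMonoid Γ] [PartialOrder Γ] [IsOrderedCancelAddMonoid Γ]
    {R S : Type*} [Semiring R] [Semiring S] (f : R →+* S) : HahnSeries Γ R →+* HahnSeries Γ S where
  toFun x := x.map f
  map_one' := HahnSeries.map_one f.toMonoidWithZeroHom
  map_mul' _ _ := HahnSeries.map_mul f.toNonUnitalRingHom
  map_zero' := HahnSeries.map_zero f.toAddMonoidHom.toZeroHom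
  map_add' _ _ := HahnSeries.map_add f.toAddMonoidHom

variable {K R Γ : Type*} [CommRing K] [CommRing R] [Algebra K R]

theorem finite_of_adjoin_eq_top_of_fg {N : Submodule K R} (hN : N.FG)
    (hint : ∀ x ∈ N, IsIntegral K x) (htop : Algebra.adjoin K (N : Set R) = ⊤) :
    Module.Finite K R := by
  obtain ⟨X, rfl⟩ := hN
  rw [Algebra.adjoin_span] at htop
  rw [Module.finite_def, ← Algebra.top_toSubmodule, ← htop]
  exact fg_adjoin_of_finite X.finite_toSet fun x hx => hint x (Submodule.subset_span hx)

theorem exists_isRoot_of_eval₂_eq_zero {L B : Type*} [Field L] [CommRing B] [IsDomain B]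
    {p : L[X]} (hp : p.Splits) (hp0 : p ≠ 0) (i : L →+* B) {b : B} (hb : p.eval₂ i b = 0) :
    ∃ a, p.IsRoot a ∧ i a = b := by
  have hpi : p.map i ≠ 0 := Polynomial.map_ne_zero hp0
  have hmem : b ∈ (p.map i).roots := by rwa [mem_roots hpi, IsRoot, eval_map]
  rw [hp.roots_map_of_ne_zero hpi, Multiset.mem_map] at hmem
  obtain ⟨a, ha, rfl⟩ := hmem
  exact ⟨a, isRoot_of_mem_roots ha, rfl⟩

variable [AddCommMonoid Γ] [LinearOrder Γ]

theorem exists_forall_coeff_eq_zero_of_fg {P : Submodule K (HahnSeries Γ R)} (hP : P.FG) :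
    ∃ a, ∀ f ∈ P, ∀ j < a, f.coeff j = 0 := by
  induction P, hP using Submodule.fg_induction with
  | singleton t =>
    refine ⟨t.order, fun f hf j hj => ?_⟩
    obtain ⟨c, rfl⟩ := Submodule.mem_span_singleton.mp hf
    rw [HahnSeries.coeff_smul, HahnSeries.coeff_eq_zero_of_lt_order hj, smul_zero]
  | sup P Q _ _ hP hQ =>
    obtain ⟨a, ha⟩ := hP
    obtain ⟨b, hb⟩ := hQ
    refine ⟨min a b, fun f hf j hj => ?_⟩
    obtain ⟨p, hp, q, hq, rfl⟩ := Submodule.mem_sup.mp hf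
    obtain ⟨hja, hjb⟩ := lt_min_iff.mp hj
    rw [HahnSeries.coeff_add, ha p hp j hja, hb q hq j hjb, add_zero]

variable [IsOrderedCancelAddMonoid Γ]

/-- Over an algebraically closed field the only Hahn series satisfying a polynomial equation are the
constants, and every prime quotient of `R` embeds into such a field. -/
theorem coeff_mul_aeval_coeff_mem_of_isPrime {p : K[X]} (hp : p.Monic) {f : HahnSeries Γ R}
    (hf : aeval f p = 0) (J : Ideal R) [J.IsPrime] (k : Γ) :
    f.coeff k * aeval (f.coeff k) p ∈ J := by
  let L := AlgebraicClosure J.ResidueField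
  let φ : R →+* L := (algebraMap J.ResidueField L).comp (algebraMap R J.ResidueField)
  have hφ {r : R} : φ r = 0 ↔ r ∈ J := by
    rw [RingHom.comp_apply, map_eq_zero, Ideal.algebraMap_residueField_eq_zero]
  let q : L[X] := p.map (φ.comp (algebraMap K R))
  have hq (a : R) : q.eval (φ a) = φ (aeval a p) := by
    rw [eval_map, aeval_def, hom_eval₂]
  have hcomp : (hahnSeriesMap Γ φ).comp (algebraMap K (HahnSeries Γ R)) =
      HahnSeries.C.comp (φ.comp (algebraMap K R)) :=
    RingHom.ext fun a => HahnSeries.map_C _ φ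
  have hqf : q.eval₂ HahnSeries.C (hahnSeriesMap Γ φ f) = 0 := by
    rw [eval₂_map, ← hcomp, ← hom_eval₂, ← aeval_def, hf, map_zero]
  obtain ⟨a, ha, haf⟩ := exists_isRoot_of_eval₂_eq_zero (IsAlgClosed.splits q)
    (hp.map _).ne_zero (HahnSeries.C (Γ := Γ)) hqf
  have hk : φ (f.coeff k) = (HahnSeries.C a : HahnSeries Γ L).coeff k := by rw [haf]; rfl
  rw [← hφ, map_mul, ← hq, hk]
  obtain rfl | hk0 := eq_or_ne k 0
  · rw [HahnSeries.C_apply, HahnSeries.coeff_single_same, ha.eq_zero, mul_zero]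
  · rw [HahnSeries.C_apply, HahnSeries.coeff_single_of_ne hk0, zero_mul]

theorem isIntegral_hahnSeries_coeff {f : HahnSeries Γ R} (hf : IsIntegral K f) (k : Γ) :
    IsIntegral K (f.coeff k) := by
  obtain ⟨p, hp, hpf⟩ := hf
  have hnil : IsNilpotent (f.coeff k * aeval (f.coeff k) p) :=
    nilpotent_iff_mem_prime.mpr fun J _ => coeff_mul_aeval_coeff_mem_of_isPrime hp hpf J k
  obtain ⟨n, hn⟩ := hnil
  refine ⟨(X * p) ^ n, (monic_X.mul hp).pow n, ?_⟩
  rw [← aeval_def, map_pow, map_mul, aeval_X, hn]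

/-- Only finitely many exponents below `k` occur in `P`, and their coefficients are integral. -/
theorem finite_quotient_span_coeff [LocallyFiniteOrder Γ] {P : Submodule K (HahnSeries Γ R)}
    (hP : P.FG) (hone : 1 ∈ P) (hmul : ∀ f g, f ∈ P → g ∈ P → f * g ∈ P)
    (htop : Algebra.adjoin K {r | ∃ f ∈ P, ∃ j, f.coeff j = r} = ⊤) (k : Γ) :
    Module.Finite K (R ⧸ Ideal.span {r | ∃ f ∈ P, ∃ j ≥ k, f.coeff j = r}) := by
  set I := Ideal.span {r | ∃ f ∈ P, ∃ j ≥ k, f.coeff j = r}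
  let π := Ideal.Quotient.mkₐ K I
  obtain ⟨a, ha⟩ := exists_forall_coeff_eq_zero_of_fg hP
  let N : Submodule K R := ⨆ j ∈ Finset.Ico a k, P.map (HahnSeries.coeff.linearMap j)
  have hN : N.FG := Submodule.fg_biSup _ _ fun j _ => hP.map _
  have hint : N ≤ (integralClosure K R).toSubmodule := by
    refine iSup₂_le fun j _ => ?_
    rintro _ ⟨f, hf, rfl⟩
    exact isIntegral_hahnSeries_coeff (.of_mem_of_fg (P.toSubalgebra hone hmul) hP f hf) j
  have hcoeff : ∀ f ∈ P, ∀ j, π (f.coeff j) ∈ N.map π.toLinearMap := by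
    intro f hf j
    rcases lt_or_ge j a with hja | hja
    · simp [ha f hf j hja]
    rcases lt_or_ge j k with hjk | hjk
    · exact Submodule.mem_map_of_mem <| Submodule.mem_iSup_of_mem j <|
        Submodule.mem_iSup_of_mem (Finset.mem_Ico.mpr ⟨hja, hjk⟩) ⟨f, hf, rfl⟩
    · have hI : f.coeff j ∈ I := Ideal.subset_span ⟨f, hf, j, hjk, rfl⟩
      rw [Ideal.Quotient.mkₐ_eq_mk, Ideal.Quotient.eq_zero_iff_mem.mpr hI]
      exact zero_mem _
  refine finite_of_adjoin_eq_top_of_fg (hN.map π.toLinearMap) ?_ ?_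
  · rintro _ ⟨x, hx, rfl⟩
    exact IsIntegral.map π (hint hx)
  · rw [eq_top_iff, ← (AlgHom.range_eq_top π).mpr (Ideal.Quotient.mkₐ_surjective K I),
      ← Algebra.map_top, ← htop, AlgHom.map_adjoin, Algebra.adjoin_le_iff]
    rintro _ ⟨_, ⟨f, hf, j, rfl⟩, rfl⟩
    exact Algebra.subset_adjoin (hcoeff f hf j)

theorem cofg_smul_top {G : Type*} [AddCommGroup G] [Module R G] [Module K G]
    [IsScalarTower K R G] [Module.Finite R G] (I : Ideal R) [Module.Finite K (R ⧸ I)] :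
    ((I • ⊤ : Submodule R G).restrictScalars K).CoFG :=
  have : Module.Finite K (G ⧸ (I • ⊤ : Submodule R G)) := Module.Finite.trans (R ⧸ I) _
  .equiv (Submodule.Quotient.restrictScalarsEquiv K (I • ⊤ : Submodule R G)).symm

end HahnSeriesCoefficients

theorem finsum_eq_sum_range {W : Type*} [AddCommMonoid W] {f : ℕ → W} {N : ℕ}
    (hf : ∀ i ≥ N, f i = 0) : ∑ᶠ i, f i = ∑ i ∈ Finset.range N, f i :=
  finsum_eq_sum_of_support_subset f fun i hi => by
    contrapose! hi
    simpa using hf i (by simpa using hi)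

theorem finsum_sub_sum_range_mem {K W : Type*} [Ring K] [AddCommGroup W] [Module K W]
    {U : Submodule K W} {f : ℕ → W} (hfin : ∃ b : ℤ, ∀ i : ℕ, b ≤ i → f i = 0) {N : ℕ}
    (hf : ∀ i ≥ N, f i ∈ U) : ∑ᶠ i, f i - ∑ i ∈ Finset.range N, f i ∈ U := by
  obtain ⟨b, hb⟩ := hfin
  have hzero (i : ℕ) (hi : i ≥ N + b.toNat) : f i = 0 := hb i (by omega)
  rw [finsum_eq_sum_range hzero, Finset.sum_range_add, add_sub_cancel_left]
  exact sum_mem fun i _ => hf _ (N.le_add_right i)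

section ModeFormulas

variable {V W : Type*} [AddCommGroup V] [Module ℂ V] [AddCommGroup W] [Module ℂ W]
  {Y : V →ₗ[ℂ] (ℤ → Module.End ℂ V)} {Y_W : V →ₗ[ℂ] (ℤ → Module.End ℂ W)}

theorem JacobiIdentity.commutator (h : JacobiIdentity Y Y_W) (u v : V) (w : W) (m n : ℤ) :
    Y_W u m (Y_W v n w) - Y_W v n (Y_W u m w) =
      ∑ᶠ i : ℕ, ((Ring.choose m i : ℤ) : ℂ) • Y_W (Y u i v) (m + n - i) w := by
  have hJ := h u v w 0 m n
  rw [finsum_eq_single _ 0 fun i hi => by simp [Ring.choose_zero_ite, hi],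
    finsum_eq_single _ 0 fun i hi => by simp [Ring.choose_zero_ite, hi]] at hJ
  simpa using hJ

theorem JacobiIdentity.iterate (h : JacobiIdentity Y Y_W) (u v : V) (w : W) (l n : ℤ) :
    Y_W (Y u l v) n w =
      (∑ᶠ i : ℕ, ((-1 : ℂ) ^ i * ((Ring.choose l i : ℤ) : ℂ)) •
        Y_W u (l - i) (Y_W v (n + i) w))
      - (∑ᶠ i : ℕ, ((-1 : ℂ) ^ l * (-1 : ℂ) ^ i * ((Ring.choose l i : ℤ) : ℂ)) •
        Y_W v (n + l - i) (Y_W u i w)) := by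
  have hJ := h u v w l 0 n
  rw [finsum_eq_single (fun i : ℕ => ((Ring.choose (0 : ℤ) i : ℤ) : ℂ) • _) 0
    fun i hi => by simp [Ring.choose_zero_ite, hi]] at hJ
  simpa using hJ.symm

/-- The coefficient of `z₀⁰`, which expresses the normally ordered product. Varying `m` chooses
where the first sum starts. -/
theorem JacobiIdentity.normal_ordered (h : JacobiIdentity Y Y_W) (u v : V) (w : W) (m n : ℤ) :
    (∑ᶠ i : ℕ, Y_W u (m - 1 - i) (Y_W v (n + i) w)) +
        ∑ᶠ i : ℕ, Y_W v (n - 1 - i) (Y_W u (m + i) w) =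
      ∑ᶠ i : ℕ, ((Ring.choose m i : ℤ) : ℂ) • Y_W (Y u (i - 1) v) (m + n - i) w := by
  have hchoose (i : ℕ) : (-1 : ℂ) ^ i * ((Ring.choose (-1 : ℤ) i : ℤ) : ℂ) = 1 := by
    rw [Ring.choose_neg, add_sub_cancel_left, Ring.choose_natCast, Nat.choose_self,
      Units.smul_def, Int.coe_negOnePow_natCast]
    simp [← mul_pow]
  have hJ := h u v w (-1) m n
  simp only [mul_assoc, hchoose] at hJ
  rw [← sub_neg_eq_add, ← finsum_neg_distrib]
  simpa [sub_eq_add_neg, add_comm, add_left_comm] using hJ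

end ModeFormulas

namespace VertexOperatorAlgebra

variable {V : Type*} [AddCommGroup V] [Module ℂ V] (A : VertexOperatorAlgebra V)

@[elab_as_elim]
theorem homogeneous_induction {p : V → Prop} (mem : ∀ k, ∀ v ∈ A.grading k, p v) (zero : p 0)
    (add : ∀ u v, p u → p v → p (u + v)) (v : V) : p v :=
  Submodule.iSup_induction (motive := p) A.grading
    (A.isInternal.submodule_iSup_eq_top ▸ Submodule.mem_top)
    mem zero add

theorem grading_eq_eigenspace (k : ℤ) :
    A.grading k = Module.End.eigenspace (A.Y A.conformal 1) (k : ℂ) := by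
  have hle (k : ℤ) : A.grading k ≤ Module.End.eigenspace (A.Y A.conformal 1) (k : ℂ) :=
    fun v hv => Module.End.mem_eigenspace_iff.mpr (A.L_zero k v hv)
  have hind : iSupIndep fun k : ℤ => Module.End.eigenspace (A.Y A.conformal 1) (k : ℂ) :=
    (Module.End.eigenspaces_iSupIndep _).comp Int.cast_injective
  exact congrFun ((hind.le_iff_eq_of_iSup_eq_top A.isInternal.submodule_iSup_eq_top).mp hle) k

theorem mode_mem_grading {d e : ℤ} {u v : V} (hu : u ∈ A.grading d) (hv : v ∈ A.grading e)
    (n : ℤ) : A.Y u n v ∈ A.grading (d + e - n - 1) := by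
  have hsupp : ∀ i ≥ 2, Ring.choose (1 : ℤ) i = 0 := fun i hi => by
    simpa [Nat.choose_eq_zero_of_lt hi] using Ring.choose_natCast (R := ℤ) 1 i
  have hcomm := A.jacobi.commutator A.conformal u v 1 n
  rw [finsum_eq_sum_range (N := 2) fun i hi => by simp [hsupp i hi],
    Finset.sum_range_succ, Finset.sum_range_one, A.L_zero e v hv] at hcomm
  simp only [Nat.cast_zero, Nat.cast_one, Ring.choose_zero_right, Ring.choose_one_right,
    Int.cast_one, one_smul, sub_zero, A.L_neg_one, A.L_zero d u hu, map_smul, Pi.smul_apply,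
    LinearMap.smul_apply, add_sub_cancel_left, sub_eq_iff_eq_add] at hcomm
  rw [grading_eq_eigenspace, Module.End.mem_eigenspace_iff, hcomm]
  push_cast
  module

namespace WeakModule

variable {A} {W : Type*} [AddCommGroup W] [Module ℂ W] (M : A.WeakModule W)

theorem mode_translate (u : V) (w : W) (n : ℤ) :
    M.Y (A.Y u (-2) A.vacuum) n w = -(n : ℂ) • M.Y u (n - 1) w := by
  have hvac {k : ℤ} (hk : k ≠ -1) : M.Y A.vacuum k = 0 := by rw [M.vacuum_mode, if_neg hk]
  have hJ := M.jacobi u A.vacuum w (-2) (n + 1) (-1)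
  rw [finsum_eq_single _ 0 fun i hi => by simp [hvac (k := -1 + i) (by omega)],
    finsum_eq_zero_of_forall_eq_zero fun i => by
      rw [hvac (by omega), LinearMap.zero_apply, smul_zero],
    finsum_eq_sum_range (N := 2) fun i hi => by simp [A.creation u (-2 + i) (by omega)],
    Finset.sum_range_succ, Finset.sum_range_one] at hJ
  simp only [Nat.cast_zero, Nat.cast_one, pow_zero, Ring.choose_zero_right, Ring.choose_one_right,
    Int.cast_one, Int.cast_add, one_mul, one_smul, sub_zero, add_zero, add_neg_cancel_right,
    Int.reduceNeg, Int.reduceAdd, M.vacuum_mode, if_pos, LinearMap.id_apply, A.creation_const,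
    show n + 1 + -2 = n - 1 by ring, ← sub_eq_iff_eq_add] at hJ
  rw [← hJ]
  module

theorem mode_mem_C {n : ℕ} (hn : 1 ≤ n) {m : ℤ} (hm : m ≤ -n) (u : V) (w : W) :
    M.Y u m w ∈ M.C n := by
  induction m, hm using Int.leInductionDown generalizing u with
  | base => exact Submodule.subset_span ⟨u, w, rfl⟩
  | pred m hm ih =>
    have hm0 : -(m : ℂ) ≠ 0 := by
      rw [neg_ne_zero, Int.cast_ne_zero]
      omega
    rw [← (M.C n).smul_mem_iff hm0, ← M.mode_translate]
    exact ih _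

end WeakModule

end VertexOperatorAlgebra

section AssociatedGraded

open Submodule

variable {K W : Type*} [CommRing K] [AddCommGroup W] [Module K W] (F : ℤ → Submodule K W)

/-- The associated graded module `⨁ p, F p / F (p - 1)` of an increasing `ℤ`-filtration `F`. -/
def AssociatedGraded : Type _ := DirectSum ℤ fun p => F p ⧸ (F (p - 1)).submoduleOf (F p)

instance : AddCommGroup (AssociatedGraded F) :=
  inferInstanceAs (AddCommGroup (DirectSum ℤ fun p => F p ⧸ (F (p - 1)).submoduleOf (F p)))

instance : Module K (AssociatedGraded F) :=
  inferInstanceAs (Module K (DirectSum ℤ fun p => F p ⧸ (F (p - 1)).submoduleOf (F p)))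

/-- The class in degree `p` of the associated graded module of an element of `F p`. -/
def symbol (p : ℤ) : F p →ₗ[K] AssociatedGraded F :=
  DirectSum.lof K ℤ (fun p => F p ⧸ (F (p - 1)).submoduleOf (F p)) p ∘ₗ mkQ _

/-- The submodule of the associated graded module spanned by the symbols of the elements of `X`. -/
def gradedSubmodule (X : Submodule K W) : Submodule K (AssociatedGraded F) :=
  ⨆ p, (X.submoduleOf (F p)).map (symbol F p)

/-- The endomorphisms which raise the filtration degree by at most `d`. -/
def filteredEnd (d : ℤ) : Submodule K (Module.End K W) where
  carrier := {T | ∀ p, ∀ x ∈ F p, T x ∈ F (p + d)}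
  zero_mem' _ _ _ := zero_mem _
  add_mem' hS hT p x hx := add_mem (hS p x hx) (hT p x hx)
  smul_mem' c _ hT p x hx := smul_mem _ c (hT p x hx)

variable {F}

theorem symbol_eq_zero {p : ℤ} {x : F p} (hx : (x : W) ∈ F (p - 1)) : symbol F p x = 0 := by
  have hmk : mkQ ((F (p - 1)).submoduleOf (F p)) x = 0 := (Quotient.mk_eq_zero _).mpr hx
  exact (congrArg (DirectSum.lof K ℤ _ p) hmk).trans (map_zero _)

theorem symbol_eq_symbol {p q : ℤ} (hpq : p = q) {x : F p} {y : F q}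
    (hxy : (x : W) - y ∈ F (p - 1)) : symbol F p x = symbol F q y := by
  subst hpq
  rw [← sub_eq_zero, ← map_sub]
  exact symbol_eq_zero hxy

variable (F) in
theorem iSup_range_symbol : ⨆ p, (symbol F p).range = ⊤ := by
  rw [eq_top_iff]
  rintro g -
  induction g using DirectSum.induction_on with
  | zero => exact zero_mem _
  | of p x =>
    obtain ⟨x, rfl⟩ := mkQ_surjective _ x
    exact mem_iSup_of_mem p ⟨x, rfl⟩
  | add g h hg hh => exact add_mem hg hh

namespace AssociatedGraded

theorem hom_ext {G : Type*} [AddCommGroup G] [Module K G] {S T : AssociatedGraded F →ₗ[K] G}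
    (h : ∀ p x, S (symbol F p x) = T (symbol F p x)) : S = T :=
  DirectSum.linearMap_ext _ fun p => linearMap_qext _ (LinearMap.ext (h p))

variable (F) in
/-- The projection of the associated graded module onto its part of degree `p`. -/
def component (p : ℤ) : AssociatedGraded F →ₗ[K] F p ⧸ (F (p - 1)).submoduleOf (F p) :=
  DirectSum.component K ℤ _ p

theorem component_symbol_self (p : ℤ) (x : F p) :
    component F p (symbol F p x) = Submodule.Quotient.mk x :=
  DirectSum.component.lof_self K ..

theorem component_symbol_of_ne {p q : ℤ} (hqp : q ≠ p) (x : F q) :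
    component F p (symbol F q x) = 0 :=
  (DirectSum.component.of ..).trans (dif_neg hqp)

/-- The linear map out of the associated graded module determined by its values on symbols. -/
def lift {G : Type*} [AddCommGroup G] [Module K G] (f : ∀ p, F p →ₗ[K] G)
    (hf : ∀ p, ∀ x : F p, (x : W) ∈ F (p - 1) → f p x = 0) : AssociatedGraded F →ₗ[K] G :=
  DirectSum.toModule K ℤ G fun p => liftQ _ (f p) (hf p)

theorem lift_symbol {G : Type*} [AddCommGroup G] [Module K G] {f : ∀ p, F p →ₗ[K] G}
    (hf : ∀ p, ∀ x : F p, (x : W) ∈ F (p - 1) → f p x = 0) {p : ℤ} (x : F p) :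
    lift f hf (symbol F p x) = f p x :=
  DirectSum.toModule_lof ..

end AssociatedGraded

theorem symbol_mem_gradedSubmodule {X : Submodule K W} {p : ℤ} {x : F p} (hx : (x : W) ∈ X) :
    symbol F p x ∈ gradedSubmodule F X :=
  mem_iSup_of_mem p (mem_map_of_mem hx)

theorem gradedSubmodule_mono : Monotone (gradedSubmodule F) := fun _ _ hXY =>
  iSup_mono fun _ => map_mono (comap_mono hXY)

theorem exists_sub_mem_of_symbol_mem {X : Submodule K W} {p : ℤ} {x : F p}
    (hx : symbol F p x ∈ gradedSubmodule F X) : ∃ y ∈ X, (x : W) - y ∈ F (p - 1) := by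
  have hle : gradedSubmodule F X ≤
      ((X.submoduleOf (F p)).map (mkQ _)).comap (AssociatedGraded.component F p) := by
    refine iSup_le fun q => map_le_iff_le_comap.mpr fun y hy => ?_
    rw [mem_comap, mem_comap]
    obtain rfl | hqp := eq_or_ne q p
    · exact ⟨y, hy, (AssociatedGraded.component_symbol_self q y).symm⟩
    · exact AssociatedGraded.component_symbol_of_ne hqp y ▸ zero_mem _
  obtain ⟨y, hy, hyx⟩ := hle hx
  rw [AssociatedGraded.component_symbol_self] at hyx
  exact ⟨y, hy, (Submodule.Quotient.eq ((F (p - 1)).submoduleOf (F p))).mp hyx.symm⟩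

theorem symbol_eq_zero_iff {p : ℤ} {x : F p} : symbol F p x = 0 ↔ (x : W) ∈ F (p - 1) := by
  refine ⟨fun hx => ?_, symbol_eq_zero⟩
  have hx0 := AssociatedGraded.component_symbol_self p x
  rw [hx, map_zero] at hx0
  exact (Submodule.Quotient.mk_eq_zero ((F (p - 1)).submoduleOf (F p))).mp hx0.symm

theorem eq_top_of_gradedSubmodule_eq_top {b : ℤ} (hbot : ∀ p < b, F p = ⊥) (htop : ⨆ p, F p = ⊤)
    {X : Submodule K W} (hX : gradedSubmodule F X = ⊤) : X = ⊤ := by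
  have hstep (p : ℤ) (hp : F (p - 1) ≤ X) : F p ≤ X := fun x hx => by
    obtain ⟨y, hy, hxy⟩ := exists_sub_mem_of_symbol_mem (x := ⟨x, hx⟩) (hX ▸ mem_top)
    simpa using add_mem (hp hxy) hy
  have hlt (p : ℤ) (hp : p < b) : F p ≤ X := hbot p hp ▸ bot_le
  rw [eq_top_iff, ← htop, iSup_le_iff]
  intro p
  rcases lt_or_ge p b with hp | hp
  · exact hlt p hp
  · induction p, hp using Int.leInduction with
    | base => exact hstep b (hlt _ (sub_one_lt b))
    | succ p _ ih => exact hstep (p + 1) (by rwa [add_sub_cancel_right])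

theorem exists_fg_mem_gradedSubmodule (g : AssociatedGraded F) :
    ∃ E : Submodule K W, E.FG ∧ g ∈ gradedSubmodule F E := by
  have hg : g ∈ ⨆ p, (symbol F p).range := iSup_range_symbol F ▸ mem_top
  induction hg using Submodule.iSup_induction' with
  | mem p g hg =>
    obtain ⟨x, rfl⟩ := hg
    exact ⟨_, fg_span_singleton (x : W),
      symbol_mem_gradedSubmodule (mem_span_singleton_self (x : W))⟩
  | zero => exact ⟨⊥, fg_bot, zero_mem _⟩
  | add g h _ _ hg hh =>
    obtain ⟨D, hD, hgD⟩ := hg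
    obtain ⟨E, hE, hhE⟩ := hh
    exact ⟨D ⊔ E, hD.sup hE, add_mem (gradedSubmodule_mono le_sup_left hgD)
      (gradedSubmodule_mono le_sup_right hhE)⟩

theorem cofg_of_cofg_gradedSubmodule {b : ℤ} (hbot : ∀ p < b, F p = ⊥) (htop : ⨆ p, F p = ⊤)
    {X : Submodule K W} (hX : (gradedSubmodule F X).CoFG) : X.CoFG := by
  have hlift (D : Submodule K (AssociatedGraded F ⧸ gradedSubmodule F X)) (hD : D.FG) :
      ∃ E : Submodule K W, E.FG ∧ D ≤ (gradedSubmodule F E).map (mkQ _) := by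
    induction D, hD using fg_induction with
    | singleton g =>
      obtain ⟨g, rfl⟩ := mkQ_surjective _ g
      obtain ⟨E, hE, hg⟩ := exists_fg_mem_gradedSubmodule g
      exact ⟨E, hE, (span_singleton_le_iff_mem _ _).mpr (mem_map_of_mem hg)⟩
    | sup D₁ D₂ _ _ h₁ h₂ =>
      obtain ⟨E₁, hE₁, hD₁⟩ := h₁
      obtain ⟨E₂, hE₂, hD₂⟩ := h₂
      exact ⟨E₁ ⊔ E₂, hE₁.sup hE₂,
        sup_le (hD₁.trans (map_mono (gradedSubmodule_mono le_sup_left)))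
          (hD₂.trans (map_mono (gradedSubmodule_mono le_sup_right)))⟩
  obtain ⟨E, hE, hle⟩ := hlift ⊤ hX.fg_top
  refine hE.cofg_of_codisjoint (codisjoint_iff.mpr (eq_top_of_gradedSubmodule_eq_top hbot htop ?_))
  rw [eq_top_iff, ← (map_mkQ_eq_top _ _).mp (top_le_iff.mp hle)]
  exact sup_le (gradedSubmodule_mono le_sup_right) (gradedSubmodule_mono le_sup_left)

variable (F) in
/-- The endomorphism of the associated graded module induced by an endomorphism which raises the
filtration degree by at most `d`. -/
def gradedEnd (d : ℤ) : filteredEnd F d →ₗ[K] Module.End K (AssociatedGraded F) where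
  toFun T := AssociatedGraded.lift (fun p => symbol F (p + d) ∘ₗ T.1.restrict (T.2 p))
    fun p x hx => symbol_eq_zero (by simpa [add_sub_right_comm] using T.2 (p - 1) x hx)
  map_add' S T := AssociatedGraded.hom_ext fun p x => by
    simp only [LinearMap.add_apply, AssociatedGraded.lift_symbol]
    exact map_add (symbol F (p + d)) (S.1.restrict (S.2 p) x) (T.1.restrict (T.2 p) x)
  map_smul' c T := AssociatedGraded.hom_ext fun p x => by
    simp only [LinearMap.smul_apply, AssociatedGraded.lift_symbol]
    exact map_smul (symbol F (p + d)) c (T.1.restrict (T.2 p) x)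

theorem gradedEnd_symbol {d : ℤ} (T : filteredEnd F d) {p : ℤ} (x : F p) :
    gradedEnd F d T (symbol F p x) = symbol F (p + d) ⟨T.1 x, T.2 p x x.2⟩ :=
  AssociatedGraded.lift_symbol _ x

end AssociatedGraded

namespace VertexOperatorAlgebra

variable {V : Type*} [AddCommGroup V] [Module ℂ V] {A : VertexOperatorAlgebra V}

variable (A) in
/-- The linear map on `V` with prescribed restrictions to the homogeneous subspaces. -/
noncomputable def homogeneousLift {G : Type*} [AddCommGroup G] [Module ℂ G]
    (f : ∀ d, A.grading d →ₗ[ℂ] G) : V →ₗ[ℂ] G :=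
  letI := A.isInternal.chooseDecomposition
  DirectSum.toModule ℂ ℤ G f ∘ₗ (DirectSum.decomposeLinearEquiv A.grading).toLinearMap

theorem homogeneousLift_apply {G : Type*} [AddCommGroup G] [Module ℂ G]
    (f : ∀ d, A.grading d →ₗ[ℂ] G) {d : ℤ} (u : A.grading d) : A.homogeneousLift f u = f d u := by
  let := A.isInternal.chooseDecomposition
  have hu : DirectSum.decompose A.grading (u : V) = DirectSum.lof ℂ ℤ _ d u :=
    DirectSum.decompose_coe A.grading u
  exact (congrArg (DirectSum.toModule ℂ ℤ G f) hu).trans (DirectSum.toModule_lof ..)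

namespace WeakModule

variable {W : Type*} [AddCommGroup W] [Module ℂ W] {M : A.WeakModule W}

/-- `F` is an increasing filtration for which every mode of a vector of weight `d` raises the degree
by at most `d`. -/
structure IsWeightFiltration (M : A.WeakModule W) (F : ℤ → Submodule ℂ W) : Prop where
  monotone : Monotone F
  mode_mem : ∀ {d : ℤ} {u : V}, u ∈ A.grading d → ∀ (n p : ℤ), ∀ x ∈ F p, M.Y u n x ∈ F (p + d)

namespace IsWeightFiltration

variable {F : ℤ → Submodule ℂ W} (hF : M.IsWeightFiltration F) {d e p : ℤ} {u v : V} {x : W}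
include hF

theorem mode_mem_of_le (hu : u ∈ A.grading d) {q : ℤ} (hq : p + d ≤ q) (hx : x ∈ F p) (n : ℤ) :
    M.Y u n x ∈ F q :=
  hF.monotone hq (hF.mode_mem hu n p x hx)

theorem commutator_mem (hu : u ∈ A.grading d) (hv : v ∈ A.grading e) (hx : x ∈ F p) (m n : ℤ) :
    M.Y u m (M.Y v n x) - M.Y v n (M.Y u m x) ∈ F (p + e + d - 1) := by
  rw [M.jacobi.commutator]
  exact finsum_induction (· ∈ F _) (zero_mem _) (fun _ _ => add_mem) fun i =>
    Submodule.smul_mem _ _ (hF.mode_mem_of_le (A.mode_mem_grading hu hv i) (by omega) hx _)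

theorem iterate_mem (hu : u ∈ A.grading d) (hv : v ∈ A.grading e) (hx : x ∈ F p) (l n : ℤ) :
    M.Y (A.Y u l v) n x ∈ F (p + d + e) := by
  rw [M.jacobi.iterate]
  exact sub_mem
    (finsum_induction (· ∈ F _) (zero_mem _) (fun _ _ => add_mem) fun i =>
      Submodule.smul_mem _ _
        (hF.mode_mem_of_le hu (by omega) (hF.mode_mem hv _ _ _ hx) _))
    (finsum_induction (· ∈ F _) (zero_mem _) (fun _ _ => add_mem) fun i =>
      Submodule.smul_mem _ _
        (hF.mode_mem_of_le hv (by omega) (hF.mode_mem hu _ _ _ hx) _))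

theorem normal_ordered_sub_sum_mem (hu : u ∈ A.grading d) (hv : v ∈ A.grading e) (hx : x ∈ F p)
    {m n : ℤ} {N : ℕ} (hum : ∀ i ≥ m, M.Y u i x ∈ F (p + d - 1))
    (hvn : ∀ i ≥ n + N, M.Y v i x ∈ F (p + e - 1)) :
    M.Y (A.Y u (-1) v) (m + n) x - ∑ i ∈ Finset.range N, M.Y u (m - 1 - i) (M.Y v (n + i) x) ∈
      F (p + (d + e) - 1) := by
  obtain ⟨a, ha⟩ := M.truncation u x
  obtain ⟨b, hb⟩ := M.truncation v x
  obtain ⟨c, hc⟩ := A.truncation u v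
  have huv := finsum_sub_sum_range_mem (U := F (p + (d + e) - 1)) (N := N)
    (f := fun i : ℕ => M.Y u (m - 1 - i) (M.Y v (n + i) x))
    ⟨b - n, fun i hi => by rw [hb _ (by omega), map_zero]⟩
    fun i hi => hF.mode_mem_of_le hu (by omega) (hvn _ (by omega)) _
  have hvu := finsum_sub_sum_range_mem (U := F (p + (d + e) - 1)) (N := 0)
    (f := fun i : ℕ => M.Y v (n - 1 - i) (M.Y u (m + i) x))
    ⟨a - m, fun i hi => by rw [ha _ (by omega), map_zero]⟩
    fun i _ => hF.mode_mem_of_le hv (by omega) (hum _ (by omega)) _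
  have hiter := finsum_sub_sum_range_mem (U := F (p + (d + e) - 1)) (N := 1)
    (f := fun i : ℕ => ((Ring.choose m i : ℤ) : ℂ) • M.Y (A.Y u (i - 1) v) (m + n - i) x)
    ⟨c + 1, fun i hi => by
      rw [hc _ (by omega), map_zero, Pi.zero_apply, LinearMap.zero_apply, smul_zero]⟩
    fun i hi => Submodule.smul_mem _ _
      (hF.mode_mem_of_le (A.mode_mem_grading hu hv _) (by omega) hx _)
  rw [← M.jacobi.normal_ordered, Finset.sum_range_one] at hiter
  convert sub_mem (add_mem huv hvu) hiter using 1
  simp only [Finset.range_zero, Finset.sum_empty, sub_zero, Ring.choose_zero_right, Int.cast_one,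
    Nat.cast_zero, zero_sub, one_smul]
  abel

end IsWeightFiltration

end WeakModule

end VertexOperatorAlgebra

namespace VertexOperatorAlgebra.WeakModule.IsWeightFiltration

variable {V : Type*} [AddCommGroup V] [Module ℂ V] {A : VertexOperatorAlgebra V}
  {W : Type*} [AddCommGroup W] [Module ℂ W] {M : A.WeakModule W} {F : ℤ → Submodule ℂ W}
  (hF : M.IsWeightFiltration F) {d e p : ℤ} {u v : V}

/-- The action of the modes on the associated graded space: for `u` of weight `d`, the mode `u_n`
acts with degree `d`. -/
noncomputable def grMode : V →ₗ[ℂ] (ℤ → Module.End ℂ (AssociatedGraded F)) :=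
  A.homogeneousLift fun d => LinearMap.pi fun n => gradedEnd F d ∘ₗ
    (LinearMap.proj n ∘ₗ M.Y ∘ₗ (A.grading d).subtype).codRestrict (filteredEnd F d)
      fun u => hF.mode_mem u.2 n

theorem grMode_symbol (hu : u ∈ A.grading d) (n : ℤ) (x : F p) :
    hF.grMode u n (symbol F p x) = symbol F (p + d) ⟨M.Y u n x, hF.mode_mem hu n p x x.2⟩ := by
  have hlift := congrFun (A.homogeneousLift_apply (fun d => LinearMap.pi fun n => gradedEnd F d ∘ₗ
    (LinearMap.proj n ∘ₗ M.Y ∘ₗ (A.grading d).subtype).codRestrict (filteredEnd F d)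
      fun u => hF.mode_mem u.2 n) ⟨u, hu⟩) n
  exact (LinearMap.congr_fun hlift _).trans (gradedEnd_symbol _ x)

theorem grMode_commute (u v : V) (m n : ℤ) : Commute (hF.grMode u m) (hF.grMode v n) := by
  induction u using A.homogeneous_induction with
  | mem d u hu =>
    induction v using A.homogeneous_induction with
    | mem e v hv =>
      refine AssociatedGraded.hom_ext fun p x => ?_
      rw [Module.End.mul_apply, Module.End.mul_apply, hF.grMode_symbol hv, hF.grMode_symbol hu,
        hF.grMode_symbol hu, hF.grMode_symbol hv]
      exact symbol_eq_symbol (add_right_comm p e d) (hF.commutator_mem hu hv x.2 m n)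
    | zero => rw [map_zero]; exact Commute.zero_right _
    | add v v' h h' => rw [map_add]; exact h.add_right h'
  | zero => rw [map_zero]; exact Commute.zero_left _
  | add u u' h h' => rw [map_add]; exact h.add_left h'

theorem grMode_vacuum (n : ℤ) : hF.grMode A.vacuum n = if n = -1 then 1 else 0 := by
  refine AssociatedGraded.hom_ext fun p x => ?_
  rw [hF.grMode_symbol A.vacuum_mem]
  split_ifs with hn
  · exact symbol_eq_symbol (add_zero p) (by simp [M.vacuum_mode, hn])
  · exact symbol_eq_zero (by simp [M.vacuum_mode, hn])

theorem grMode_iterate_neg_two (u v : V) : hF.grMode (A.Y u (-2) v) = 0 := by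
  induction u using A.homogeneous_induction with
  | mem d u hu =>
    induction v using A.homogeneous_induction with
    | mem e v hv =>
      refine funext fun n => AssociatedGraded.hom_ext fun p x => ?_
      rw [hF.grMode_symbol (A.mode_mem_grading hu hv (-2))]
      exact symbol_eq_zero <|
        hF.monotone (by omega) (hF.iterate_mem hu hv x.2 (-2) n)
    | zero => rw [map_zero, map_zero]
    | add v v' h h' => rw [map_add, map_add, h, h', add_zero]
  | zero => rw [map_zero, Pi.zero_apply, LinearMap.zero_apply, map_zero]
  | add u u' h h' => rw [map_add, Pi.add_apply, LinearMap.add_apply, map_add, h, h', add_zero]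

theorem grMode_eq_zero_of_mem_C (hu : u ∈ A.C 2) : hF.grMode u = 0 := by
  have hle : A.C 2 ≤ LinearMap.ker hF.grMode := Submodule.span_le.mpr <| by
    rintro _ ⟨u, v, rfl⟩
    exact hF.grMode_iterate_neg_two u v
  exact hle hu

theorem grMode_normal_ordered (hu : u ∈ A.grading d) (hv : v ∈ A.grading e) {m n : ℤ} {N : ℕ}
    (hum : ∀ i ≥ m, hF.grMode u i = 0) (hvn : ∀ i ≥ n + N, hF.grMode v i = 0) :
    hF.grMode (A.Y u (-1) v) (m + n) =
      ∑ i ∈ Finset.range N, hF.grMode u (m - 1 - i) * hF.grMode v (n + i) := by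
  have hlow {k q : ℤ} {w : V} (hw : w ∈ A.grading k) {i : ℤ} (hi : hF.grMode w i = 0) (x : F q) :
      M.Y w i x ∈ F (q + k - 1) := by
    have hx := hF.grMode_symbol hw i x
    rw [hi, LinearMap.zero_apply] at hx
    exact symbol_eq_zero_iff.mp hx.symm
  have huv : A.Y u (-1) v ∈ A.grading (d + e) := by
    simpa using A.mode_mem_grading hu hv (-1)
  refine AssociatedGraded.hom_ext fun p x => ?_
  rw [hF.grMode_symbol huv, LinearMap.sum_apply]
  simp only [Module.End.mul_apply, hF.grMode_symbol hv, hF.grMode_symbol hu]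
  rw [← map_sum]
  refine symbol_eq_symbol (by ring) ?_
  rw [AddSubmonoidClass.coe_finsetSum]
  exact hF.normal_ordered_sub_sum_mem hu hv x.2 (fun i hi => hlow hu (hum i hi) x)
    fun i hi => hlow hv (hvn i hi) x

/-- The algebra of endomorphisms of the associated graded space generated by the modes. -/
noncomputable def modeAlgebra : Subalgebra ℂ (Module.End ℂ (AssociatedGraded F)) :=
  Algebra.adjoin ℂ {T | ∃ u n, hF.grMode u n = T}

theorem grMode_mem_modeAlgebra (u : V) (n : ℤ) : hF.grMode u n ∈ hF.modeAlgebra :=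
  Algebra.subset_adjoin ⟨u, n, rfl⟩

open scoped IsMulCommutative in
noncomputable instance : CommRing hF.modeAlgebra :=
  have : IsMulCommutative hF.modeAlgebra := Algebra.isMulCommutative_adjoin ℂ <| by
    rintro _ ⟨u, m, rfl⟩ _ ⟨v, n, rfl⟩
    exact hF.grMode_commute u v m n
  inferInstance

/-- The Laurent series `∑ u_n z^{-n-1}` formed by the modes of `u` on the associated graded
space. -/
noncomputable def grField (htrunc : ∀ u, ∃ N, ∀ n ≥ N, hF.grMode u n = 0) :
    V →ₗ[ℂ] HahnSeries ℤ hF.modeAlgebra where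
  toFun u := HahnSeries.ofSuppBddBelow
    (fun j => ⟨hF.grMode u (-j - 1), hF.grMode_mem_modeAlgebra u (-j - 1)⟩) <| by
      obtain ⟨N, hN⟩ := htrunc u
      refine ⟨-N, fun j hj => ?_⟩
      contrapose! hj
      exact fun h => h (Subtype.ext (hN _ (by omega)))
  map_add' u v := by
    ext j
    simp
  map_smul' c u := by
    ext j
    simp

variable {htrunc : ∀ u, ∃ N, ∀ n ≥ N, hF.grMode u n = 0}

theorem coe_coeff_grField (u : V) (j : ℤ) :
    ((hF.grField htrunc u).coeff j : Module.End ℂ (AssociatedGraded F)) = hF.grMode u (-j - 1) :=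
  rfl

theorem grField_vacuum : hF.grField htrunc A.vacuum = 1 := by
  ext1
  funext j
  refine Subtype.ext ?_
  rw [coe_coeff_grField, grMode_vacuum, HahnSeries.coeff_one]
  obtain rfl | hj := eq_or_ne j 0
  · rw [if_pos (by norm_num), if_pos rfl, OneMemClass.coe_one]
  · rw [if_neg (by omega), if_neg hj, ZeroMemClass.coe_zero]

theorem grField_normal_ordered (u v : V) :
    hF.grField htrunc (A.Y u (-1) v) = hF.grField htrunc u * hF.grField htrunc v := by
  induction u using A.homogeneous_induction with
  | mem d u hu =>
    induction v using A.homogeneous_induction with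
    | mem e v hv =>
      obtain ⟨a, ha⟩ := htrunc u
      obtain ⟨b, hb⟩ := htrunc v
      ext1
      funext k
      refine Subtype.ext ?_
      obtain ⟨N, hN⟩ : ∃ N : ℕ, b ≤ -a - k - 1 + N := ⟨(b + a + k + 1).toNat, by omega⟩
      rw [hahnSeries_coeff_mul_eq_sum_range (a := -a) (N := N)
        (fun j hj => Subtype.ext (ha _ (by omega))) fun j hj => Subtype.ext (hb _ (by omega))]
      have hmul := hF.grMode_normal_ordered hu hv (m := a) (n := -a - k - 1) ha
        fun i hi => hb i (hN.trans hi)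
      rw [AddSubmonoidClass.coe_finsetSum, coe_coeff_grField]
      simp only [MulMemClass.coe_mul, coe_coeff_grField]
      convert hmul using 4 <;> ring
    | zero => rw [map_zero, map_zero, mul_zero]
    | add v v' h h' => rw [map_add, map_add, h, h', map_add, mul_add]
  | zero => rw [map_zero, map_zero, Pi.zero_apply, LinearMap.zero_apply, map_zero, zero_mul]
  | add u u' h h' =>
    rw [map_add, Pi.add_apply, LinearMap.add_apply, map_add, h, h', map_add, add_mul]

theorem fg_range_grField (hV : A.IsCofinite 2) : (hF.grField htrunc).range.FG := by
  have hker : A.C 2 ≤ (hF.grField htrunc).ker := fun u hu => by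
    ext1
    funext j
    exact Subtype.ext (congrFun (hF.grMode_eq_zero_of_mem_C hu) _)
  have : FiniteDimensional ℂ (V ⧸ A.C 2) := hV
  rw [← Submodule.range_liftQ _ _ hker]
  exact Module.Finite.iff_fg.mp inferInstance

/-- The ideal of the mode algebra generated by the modes `u_m` with `m ≤ n`. -/
noncomputable def modeIdeal (n : ℤ) : Ideal hF.modeAlgebra :=
  Ideal.span {r | ∃ u, ∃ m ≤ n, hF.grMode u m = r}

theorem finite_quotient_modeIdeal (htrunc : ∀ u, ∃ N, ∀ n ≥ N, hF.grMode u n = 0)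
    (hV : A.IsCofinite 2) (n : ℤ) : Module.Finite ℂ (hF.modeAlgebra ⧸ hF.modeIdeal n) := by
  have hcoeff : {r | ∃ f ∈ (hF.grField htrunc).range, ∃ j ≥ -n - 1, f.coeff j = r} =
      {r : hF.modeAlgebra | ∃ u, ∃ m ≤ n, hF.grMode u m = r} := by
    ext r
    constructor
    · rintro ⟨_, ⟨u, rfl⟩, j, hj, rfl⟩
      exact ⟨u, -j - 1, by omega, rfl⟩
    · rintro ⟨u, m, hm, hr⟩
      refine ⟨_, ⟨u, rfl⟩, -m - 1, by omega, Subtype.ext ?_⟩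
      rw [coe_coeff_grField, ← hr, show -(-m - 1) - 1 = m by ring]
  rw [modeIdeal, ← hcoeff]
  refine finite_quotient_span_coeff (hF.fg_range_grField hV) ⟨A.vacuum, hF.grField_vacuum⟩ ?_ ?_ _
  · rintro _ _ ⟨u, rfl⟩ ⟨v, rfl⟩
    exact ⟨A.Y u (-1) v, hF.grField_normal_ordered u v⟩
  · have htop : Algebra.adjoin ℂ {r : hF.modeAlgebra | ∃ u n, hF.grMode u n = r} = ⊤ :=
      Algebra.adjoin_adjoin_coe_preimage
    rw [eq_top_iff, ← htop]
    refine Algebra.adjoin_mono ?_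
    rintro r ⟨u, m, hr⟩
    refine ⟨_, ⟨u, rfl⟩, -m - 1, Subtype.ext ?_⟩
    rw [coe_coeff_grField, ← hr, show -(-m - 1) - 1 = m by ring]

end VertexOperatorAlgebra.WeakModule.IsWeightFiltration

namespace VertexOperatorAlgebra.WeakModule

variable {V : Type*} [AddCommGroup V] [Module ℂ V] {A : VertexOperatorAlgebra V}
  {W : Type*} [AddCommGroup W] [Module ℂ W] (M : A.WeakModule W) (S : Set W)

/-- The set `S` generates the weak module: `W` is the only weak submodule containing `S`. -/
def IsGeneratedBy : Prop :=
  ∀ U : Submodule ℂ W, (∀ (v : V) (n : ℤ), ∀ w ∈ U, M.Y v n w ∈ U) → S ⊆ U → U = ⊤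

/-- The smallest weight filtration whose part of degree `0` contains `S`. -/
def generatedFiltration (p : ℤ) : Submodule ℂ W :=
  ⨅ (F : ℤ → Submodule ℂ W) (_ : M.IsWeightFiltration F) (_ : S ⊆ F 0), F p

variable {M S}

theorem mem_generatedFiltration {p : ℤ} {x : W} : x ∈ M.generatedFiltration S p ↔
    ∀ F : ℤ → Submodule ℂ W, M.IsWeightFiltration F → S ⊆ F 0 → x ∈ F p := by
  simp only [generatedFiltration, Submodule.mem_iInf]

theorem generatedFiltration_le {F : ℤ → Submodule ℂ W} (hF : M.IsWeightFiltration F)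
    (hS : S ⊆ F 0) (p : ℤ) : M.generatedFiltration S p ≤ F p :=
  fun _ hx => mem_generatedFiltration.mp hx F hF hS

theorem subset_generatedFiltration : S ⊆ M.generatedFiltration S 0 :=
  fun _ hs => mem_generatedFiltration.mpr fun _ _ hS => hS hs

variable (M S) in
theorem isWeightFiltration_generatedFiltration :
    M.IsWeightFiltration (M.generatedFiltration S) where
  monotone _ _ hpq _ hx := mem_generatedFiltration.mpr fun F hF hS =>
    hF.monotone hpq (mem_generatedFiltration.mp hx F hF hS)
  mode_mem hu n p x hx := mem_generatedFiltration.mpr fun F hF hS =>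
    hF.mode_mem hu n p x (mem_generatedFiltration.mp hx F hF hS)

theorem generatedFiltration_eq_bot (hA : ∀ n < 0, A.grading n = ⊥) {p : ℤ} (hp : p < 0) :
    M.generatedFiltration S p = ⊥ := by
  let F (q : ℤ) : Submodule ℂ W := if q < 0 then ⊥ else ⊤
  have hF : M.IsWeightFiltration F :=
    { monotone := fun q r hqr => by
        by_cases hr : r < 0
        · simp [F, hr, hqr.trans_lt hr]
        · simp [F, hr]
      mode_mem := fun {d u} hu n q x hx => by
        by_cases hd : d < 0
        · obtain rfl : u = 0 := by simpa [hA d hd] using hu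
          simp
        by_cases hq : q < 0
        · obtain rfl : x = 0 := by simpa [F, hq] using hx
          simp
        · simp [F, show ¬ q + d < 0 by omega] }
  have hle := generatedFiltration_le (S := S) hF (by simp [F]) p
  rwa [show F p = ⊥ from if_pos hp, le_bot_iff] at hle

theorem iSup_generatedFiltration (hS : M.IsGeneratedBy S) :
    ⨆ p, M.generatedFiltration S p = ⊤ := by
  have hF := M.isWeightFiltration_generatedFiltration S
  refine hS _ (fun v n w hw => ?_) fun s hs =>
    Submodule.mem_iSup_of_mem 0 (subset_generatedFiltration hs)
  induction v using A.homogeneous_induction with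
  | mem d v hv =>
    rw [Submodule.mem_iSup_of_directed _ hF.monotone.directed_le] at hw ⊢
    obtain ⟨p, hp⟩ := hw
    exact ⟨p + d, hF.mode_mem hv n p w hp⟩
  | zero => simp
  | add u v hu hv =>
    rw [map_add, Pi.add_apply, LinearMap.add_apply]
    exact add_mem hu hv

namespace IsWeightFiltration

theorem map_comap_symbol {F : ℤ → Submodule ℂ W} (hF : M.IsWeightFiltration F)
    (N : Submodule hF.modeAlgebra (AssociatedGraded F)) :
    M.IsWeightFiltration fun p =>
      ((N.restrictScalars ℂ).comap (symbol F p)).map (F p).subtype where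
  monotone p q hpq := by
    rintro _ ⟨x, hx, rfl⟩
    refine ⟨⟨x, hF.monotone hpq x.2⟩, ?_, rfl⟩
    obtain rfl | hpq := hpq.eq_or_lt
    · exact hx
    · rw [SetLike.mem_coe, Submodule.mem_comap,
        symbol_eq_zero (hF.monotone (Int.le_sub_one_of_lt hpq) x.2)]
      exact zero_mem _
  mode_mem {d u} hu n p := by
    rintro _ ⟨x, hx, rfl⟩
    refine ⟨⟨M.Y u n x, hF.mode_mem hu n p x x.2⟩, ?_, rfl⟩
    rw [SetLike.mem_coe, Submodule.mem_comap, ← hF.grMode_symbol hu]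
    exact N.smul_mem ⟨hF.grMode u n, hF.grMode_mem_modeAlgebra u n⟩ hx

end IsWeightFiltration

variable (M S) in
theorem span_symbol_generatedFiltration :
    Submodule.span (M.isWeightFiltration_generatedFiltration S).modeAlgebra
      (Set.range fun s : S =>
        symbol (M.generatedFiltration S) 0 ⟨s, subset_generatedFiltration s.2⟩) = ⊤ := by
  have hF := M.isWeightFiltration_generatedFiltration S
  let N : Submodule hF.modeAlgebra (AssociatedGraded (M.generatedFiltration S)) :=
    Submodule.span _ (Set.range fun s : S => symbol _ 0 ⟨s, subset_generatedFiltration s.2⟩)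
  have hle := generatedFiltration_le (hF.map_comap_symbol N) fun s hs =>
      ⟨⟨s, subset_generatedFiltration hs⟩, Submodule.subset_span ⟨⟨s, hs⟩, rfl⟩, rfl⟩
  rw [← Submodule.restrictScalars_eq_top_iff ℂ, eq_top_iff, ← iSup_range_symbol, iSup_le_iff]
  rintro p _ ⟨x, rfl⟩
  obtain ⟨y, hy, hyx⟩ := hle p x.2
  rwa [← Subtype.ext hyx]

theorem exists_grMode_generatedFiltration_eq_zero (hS : S.Finite) (u : V) :
    ∃ N, ∀ n ≥ N, (M.isWeightFiltration_generatedFiltration S).grMode u n = 0 := by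
  set hF := M.isWeightFiltration_generatedFiltration S
  rw [← Filter.eventually_atTop]
  induction u using A.homogeneous_induction with
  | mem d u hu =>
    have hSu : ∀ᶠ n in Filter.atTop, ∀ s ∈ S, M.Y u n s = 0 :=
      (Filter.eventually_all_finite hS).mpr fun s _ =>
        Filter.eventually_atTop.mpr (M.truncation u s)
    filter_upwards [hSu] with n hn
    let T : hF.modeAlgebra := ⟨hF.grMode u n, hF.grMode_mem_modeAlgebra u n⟩
    have hT : LinearMap.lsmul hF.modeAlgebra
        (AssociatedGraded (M.generatedFiltration S)) T = 0 := by
      refine LinearMap.ext_on (M.span_symbol_generatedFiltration S) ?_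
      rintro _ ⟨s, rfl⟩
      refine (hF.grMode_symbol hu n _).trans (symbol_eq_zero ?_)
      simp only [hn s s.2, zero_mem]
    exact LinearMap.ext fun g => LinearMap.congr_fun hT g
  | zero => simp
  | add u v hu hv =>
    filter_upwards [hu, hv] with n hun hvn
    rw [map_add, Pi.add_apply, hun, hvn, add_zero]

theorem IsWeightFiltration.grMode_mem_gradedSubmodule_C {F : ℤ → Submodule ℂ W}
    (hF : M.IsWeightFiltration F) {n : ℕ} (hn : 1 ≤ n) {m : ℤ} (hm : m ≤ -n) (u : V)
    (g : AssociatedGraded F) : hF.grMode u m g ∈ gradedSubmodule F (M.C n) := by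
  induction u using A.homogeneous_induction with
  | mem d u hu =>
    have hg : g ∈ ⨆ p, (symbol F p).range := iSup_range_symbol F ▸ Submodule.mem_top
    refine (iSup_le fun p => ?_ : _ ≤ (gradedSubmodule F (M.C n)).comap (hF.grMode u m)) hg
    rintro _ ⟨x, rfl⟩
    rw [Submodule.mem_comap, hF.grMode_symbol hu]
    exact symbol_mem_gradedSubmodule (M.mode_mem_C hn hm u x)
  | zero => simp
  | add u v hu hv =>
    rw [map_add, Pi.add_apply, LinearMap.add_apply]
    exact add_mem hu hv

theorem IsWeightFiltration.smul_mem_gradedSubmodule_C {F : ℤ → Submodule ℂ W}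
    (hF : M.IsWeightFiltration F) {n : ℕ} (hn : 1 ≤ n) {r : hF.modeAlgebra}
    (hr : r ∈ hF.modeIdeal (-n)) (g : AssociatedGraded F) :
    r • g ∈ gradedSubmodule F (M.C n) := by
  induction hr using Submodule.span_induction generalizing g with
  | mem r hr =>
    obtain ⟨u, m, hm, hr⟩ := hr
    rw [Subalgebra.smul_def, ← hr]
    exact hF.grMode_mem_gradedSubmodule_C hn hm u g
  | zero => rw [zero_smul]; exact zero_mem _
  | add r s _ _ hr hs => rw [add_smul]; exact add_mem (hr g) (hs g)
  | smul a r _ hr =>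
    rw [smul_eq_mul, mul_comm, mul_smul]
    exact hr _

theorem cofg_gradedSubmodule_C (hV : A.IsCofinite 2) (hS : S.Finite) {n : ℕ} (hn : 1 ≤ n) :
    (gradedSubmodule (M.generatedFiltration S) (M.C n)).CoFG := by
  have hF := M.isWeightFiltration_generatedFiltration S
  have := hS.to_subtype
  have : Module.Finite hF.modeAlgebra (AssociatedGraded (M.generatedFiltration S)) :=
    ⟨M.span_symbol_generatedFiltration S ▸ Submodule.fg_span (Set.finite_range _)⟩
  have := hF.finite_quotient_modeIdeal (exists_grMode_generatedFiltration_eq_zero hS) hV (-n)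
  have hcofg := cofg_smul_top (K := ℂ) (G := AssociatedGraded (M.generatedFiltration S))
    (hF.modeIdeal (-n))
  refine hcofg.of_le fun g hg => ?_
  rw [Submodule.restrictScalars_mem] at hg
  exact Submodule.smul_induction_on hg
    (fun r hr g _ => hF.smul_mem_gradedSubmodule_C hn hr g) fun _ _ => add_mem

end VertexOperatorAlgebra.WeakModule

open VertexOperatorAlgebra WeakModule in
theorem proposition5p2_general {V : Type*} [AddCommGroup V] [Module ℂ V]
    (A : VertexOperatorAlgebra V) (hA : ∀ n < 0, A.grading n = ⊥) (hV : A.IsCofinite 2)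
    {W : Type*} [AddCommGroup W] [Module ℂ W] (M : A.WeakModule W) {S : Set W} (hS : S.Finite)
    (hM : M.IsGeneratedBy S) {n : ℕ} (hn : 1 ≤ n) : M.IsCofinite n :=
  cofg_of_cofg_gradedSubmodule (fun _ => generatedFiltration_eq_bot hA)
    (iSup_generatedFiltration hM) (cofg_gradedSubmodule_C hV hS hn)

theorem proposition5p2 {V : Type*} [AddCommGroup V] [Module ℂ V] (A : VertexOperatorAlgebra V)
    (hCFT : A.IsCFTType) (hV : A.IsCofinite 2)
    {W : Type*} [AddCommGroup W] [Module ℂ W] (M : A.WeakModule W) (hM : M.IsIrreducible) :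
    M.IsCofinite 2 := by
  obtain ⟨hW, hsub⟩ := hM
  obtain ⟨w, hw⟩ := exists_ne (0 : W)
  refine proposition5p2_general A hCFT.1 hV M (Set.finite_singleton w) (fun U hU hwU => ?_)
    one_le_two
  exact (hsub U hU).resolve_left fun hbot => hw (by simpa [hbot] using hwU)
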